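/- Let $\mathcal H=L^2(\mathbb R)$ and, for $q,p\in\mathbb R$, let $U(q),V(p)$ be the unitary operators on $\mathcal H$ given by $[U(q)\psi](x)=\psi(x-q)$ and $[V(p)\psi](x)=e^{ipx}\psi(x)$. An observable on a measurable space $(\Omega,\mathcal A)$ is a map $E$ from $\mathcal A$ to the bounded operators on $\mathcal H$ that is $\sigma$-additive in the weak operator topology and satisfies $E(X)\ge O$ for all $X\in\mathcal A$ and $E(\Omega)=I$; its range is $\operatorname{ran}(E)=\{E(X)\mid X\in\mathcal A\}$. Two observables $E_1,E_2$ are coexistent if there is an observable $G$ on some measurable space with $\operatorname{ran}(E_1)\cup\operatorname{ran}(E_2)\subseteq\operatorname{ran}(G)$. An observable $E$ on the Borel sets $\mathcal B(\mathbb R)$ is a position observable if $U(q)E(X)U(q)^*=E(X+q)$ and $V(p)E(X)V(p)^*=E(X)$ for all $q,p\in\mathbb R$ and $X\in\mathcal B(\mathbb R)$. An observable $F$ on $\mathcal B(\mathbb R)$ is a momentum observable if $V(p)F(Y)V(p)^*=F(Y+p)$ and $U(q)F(Y)U(q)^*=F(Y)$ for all $q,p\in\mathbb R$ and $Y\in\mathcal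 B(\mathbb R)$. Proposition. Let $E$ be a position observable and $F$ a momentum observable. If $\operatorname{ran}(E)\cup\operatorname{ran}(F)$ contains a nontrivial projection (an orthogonal projection different from $O$ and $I$), then $E$ and $F$ are not coexistent. -/

import Mathlib

open MeasureTheory

open scoped InnerProductSpace

universe u v w x

noncomputable section

/-- An observable: a normalized positive operator measure on a measurable space `Ω`, with values in
the bounded operators of a Hilbert space `H`, `σ`-additive in the weak operator topology.
Only the values on measurable sets are meaningful. -/
structure Observable (Ω : Type u) [MeasurableSpace Ω] (H : Type v)
    [NormedAddCommGroup H] [InnerProductSpace ℂ H] where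
  /-- the operator assigned to a (measurable) set -/
  toFun : Set Ω → (H →L[ℂ] H)
  isPositive : ∀ X : Set Ω, MeasurableSet X → (toFun X).IsPositive
  normalized : toFun Set.univ = 1
  sigmaAdditive : ∀ X : ℕ → Set Ω, (∀ i, MeasurableSet (X i)) →
    (∀ i j, i ≠ j → Disjoint (X i) (X j)) →
    ∀ φ ψ : H, HasSum (fun i => ⟪φ, toFun (X i) ψ⟫_ℂ) ⟪φ, toFun (⋃ i, X i) ψ⟫_ℂ

instance (Ω : Type u) [MeasurableSpace Ω] (H : Type v)
    [NormedAddCommGroup H] [InnerProductSpace ℂ H] :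
    CoeFun (Observable Ω H) (fun _ => Set Ω → (H →L[ℂ] H)) :=
  ⟨Observable.toFun⟩

/-- The range of an observable: its values on the measurable sets. -/
def Observable.ran {Ω : Type u} [MeasurableSpace Ω] {H : Type v}
    [NormedAddCommGroup H] [InnerProductSpace ℂ H] (E : Observable Ω H) : Set (H →L[ℂ] H) :=
  {A | ∃ X : Set Ω, MeasurableSet X ∧ E X = A}

/-- Two observables are coexistent if both ranges lie in the range of a single observable `G`
(on a measurable space in an arbitrary fixed universe). -/
def Coexistent {Ω₁ : Type u} {Ω₂ : Type v} [MeasurableSpace Ω₁] [MeasurableSpace Ω₂] {H : Type w}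
    [NormedAddCommGroup H] [InnerProductSpace ℂ H]
    (E₁ : Observable Ω₁ H) (E₂ : Observable Ω₂ H) : Prop :=
  ∃ (Ω : Type x) (_ : MeasurableSpace Ω) (G : Observable Ω H), E₁.ran ∪ E₂.ran ⊆ G.ran

/-- The Hilbert space `L²(ℝ)` of complex square-integrable functions. -/
abbrev L2R : Type := Lp ℂ 2 (volume : Measure ℝ)

/-- Space translation: `(U(q)ψ)(x) = ψ(x - q)`. -/
def spaceTranslation (q : ℝ) : L2R →L[ℂ] L2R :=
  (Lp.compMeasurePreservingₗᵢ ℂ (fun x : ℝ => x - q)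
    (measurePreserving_sub_right volume q)).toContinuousLinearMap

theorem spaceTranslation_ae (q : ℝ) (ψ : L2R) :
    spaceTranslation q ψ =ᵐ[volume] fun x => ψ (x - q) :=
  Lp.coeFn_compMeasurePreserving ψ (measurePreserving_sub_right volume q)

theorem norm_boost_mul (p : ℝ) (f : ℝ → ℂ) (x : ℝ) :
    ‖Complex.exp (Complex.I * p * x) * f x‖ = ‖f x‖ := by
  have h : Complex.I * p * x = ((p * x : ℝ) : ℂ) * Complex.I := by push_cast; ring
  rw [norm_mul, h, Complex.norm_exp_ofReal_mul_I, one_mul]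

theorem memLp_boost (p : ℝ) (ψ : L2R) :
    MemLp (fun x : ℝ => Complex.exp (Complex.I * p * x) * ψ x) 2 volume := by
  refine (Lp.memLp ψ).of_le (AEStronglyMeasurable.mul ?_ (Lp.aestronglyMeasurable ψ)) ?_
  · exact Continuous.aestronglyMeasurable (by fun_prop)
  · exact Filter.Eventually.of_forall fun x => (norm_boost_mul p ψ x).le

/-- Velocity boost: `(V(p)ψ)(x) = exp(ipx) ψ(x)`. -/
def velocityBoost (p : ℝ) : L2R →L[ℂ] L2R :=
  LinearMap.mkContinuous
    { toFun := fun ψ => (memLp_boost p ψ).toLp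
      map_add' := fun φ ψ => by
        ext1
        filter_upwards [(memLp_boost p (φ + ψ)).coeFn_toLp, (memLp_boost p φ).coeFn_toLp,
          (memLp_boost p ψ).coeFn_toLp, Lp.coeFn_add φ ψ,
          Lp.coeFn_add (memLp_boost p φ).toLp (memLp_boost p ψ).toLp] with x h1 h2 h3 h4 h5
        rw [h1, h5, Pi.add_apply, h2, h3, h4, Pi.add_apply, mul_add]
      map_smul' := fun c ψ => by
        ext1
        filter_upwards [(memLp_boost p (c • ψ)).coeFn_toLp, (memLp_boost p ψ).coeFn_toLp,
          Lp.coeFn_smul c ψ, Lp.coeFn_smul c (memLp_boost p ψ).toLp] with x h1 h2 h3 h4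
        rw [h1, RingHom.id_apply, h4, Pi.smul_apply, h2, h3, Pi.smul_apply]
        simp only [smul_eq_mul]
        ring }
    1 fun ψ => by
      rw [one_mul]
      refine Lp.norm_le_norm_of_ae_le ?_
      filter_upwards [(memLp_boost p ψ).coeFn_toLp] with x h
      exact (congrArg norm h).trans_le (norm_boost_mul p ψ x).le

theorem velocityBoost_ae (p : ℝ) (ψ : L2R) :
    velocityBoost p ψ =ᵐ[volume] fun x => Complex.exp (Complex.I * p * x) * ψ x :=
  (memLp_boost p ψ).coeFn_toLp

/-- A position observable: translation covariant, `U(q)E(X)U(q)* = E(X + q)`, and velocity boost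
invariant, `V(p)E(X)V(p)* = E(X)`, for all real `q, p` and all Borel sets `X`. -/
def IsPositionObservable (E : Observable ℝ L2R) : Prop :=
  (∀ (q : ℝ) (X : Set ℝ), MeasurableSet X →
    spaceTranslation q ∘L E X ∘L ContinuousLinearMap.adjoint (spaceTranslation q)
      = E ((fun y => y + q) '' X)) ∧
  (∀ (p : ℝ) (X : Set ℝ), MeasurableSet X →
    velocityBoost p ∘L E X ∘L ContinuousLinearMap.adjoint (velocityBoost p) = E X)

/-- A momentum observable: velocity boost covariant, `V(p)F(Y)V(p)* = F(Y + p)`, and translation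
invariant, `U(q)F(Y)U(q)* = F(Y)`, for all real `q, p` and all Borel sets `Y`. -/
def IsMomentumObservable (F : Observable ℝ L2R) : Prop :=
  (∀ (p : ℝ) (Y : Set ℝ), MeasurableSet Y →
    velocityBoost p ∘L F Y ∘L ContinuousLinearMap.adjoint (velocityBoost p)
      = F ((fun y => y + p) '' Y)) ∧
  (∀ (q : ℝ) (Y : Set ℝ), MeasurableSet Y →
    spaceTranslation q ∘L F Y ∘L ContinuousLinearMap.adjoint (spaceTranslation q) = F Y)

end

/-! ### Operator inequalities. -/

section Operators

variable {H : Type*} [NormedAddCommGroup H] [InnerProductSpace ℂ H]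

/-! Suppose both ranges lie in the range of `G`, and let `P = G Z` be the given projection. A
positive operator below a projection commutes with it. Splitting a set along `Z` therefore shows
that `P` commutes with the whole range of `G`, hence with every `E X` and every `F Y`
(`commute_of_isStarProjection`).

Say `P` is a value of `E`, so that it commutes with all boosts `V p`. The operator `A = ∫ exp(iqy)
dF(y)` commutes with translations by invariance of `F`, and by covariance it satisfies the same
exchange relation with `V p` as `star (U q)`. Thus `A * U q` commutes with the whole Weyl system,
and irreducibility (`exists_eq_smul_one_of_commute`) gives `A = c • star (U q)`. A characteristic
function is continuous and nonzero at `0`, so `c ≠ 0` for small `q`. Since `P` commutes with `A`, it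
commutes with `U q` for small `q`, and by taking powers for all `q`. Irreducibility makes `P`
scalar, and a scalar idempotent is `0` or `1`.

If `P` is a value of `F`, the same argument applies with position and momentum exchanged
(`eq_zero_or_eq_one_of_commute_covariant` covers both cases). -/

theorem eq_of_inner_self_eq {S T : H →L[ℂ] H} (h : ∀ ψ : H, ⟪ψ, S ψ⟫_ℂ = ⟪ψ, T ψ⟫_ℂ) : S = T := by
  have : (S : H →ₗ[ℂ] H) = T := by
    rw [← ext_inner_map]
    intro ψ
    have := congrArg (starRingEnd ℂ) (h ψ)
    rwa [inner_conj_symm, inner_conj_symm] at this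
  exact ContinuousLinearMap.coe_injective this

/-- The operator norm is at most twice the numerical radius. -/
theorem norm_le_two_mul_of_norm_inner_self_le {T : H →L[ℂ] H} {w : ℝ} (hw : 0 ≤ w)
    (h : ∀ ψ : H, ‖⟪ψ, T ψ⟫_ℂ‖ ≤ w * ‖ψ‖ ^ 2) : ‖T‖ ≤ 2 * w := by
  have h' (ψ : H) : ‖⟪T ψ, ψ⟫_ℂ‖ ≤ w * ‖ψ‖ ^ 2 := by rw [norm_inner_symm]; exact h ψ
  have hsesq (a b : H) : ‖⟪T b, a⟫_ℂ‖ ≤ w * (‖a‖ ^ 2 + ‖b‖ ^ 2) := by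
    have hpol := inner_map_polarization (T : H →ₗ[ℂ] H) a b
    simp only [ContinuousLinearMap.coe_coe] at hpol
    have h1 := parallelogram_law_with_norm ℂ a b
    have h2 := parallelogram_law_with_norm ℂ a (Complex.I • b)
    rw [norm_smul, Complex.norm_I, one_mul] at h2
    rw [hpol, norm_div, Complex.norm_ofNat, div_le_iff₀ (by norm_num)]
    calc _ ≤ ‖⟪T (a + b), a + b⟫_ℂ‖ + ‖⟪T (a - b), a - b⟫_ℂ‖
          + ‖Complex.I * ⟪T (a + Complex.I • b), a + Complex.I • b⟫_ℂ‖
          + ‖Complex.I * ⟪T (a - Complex.I • b), a - Complex.I • b⟫_ℂ‖ :=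
          (norm_sub_le _ _).trans (add_le_add_left ((norm_add_le _ _).trans
            (add_le_add_left (norm_sub_le _ _) _)) _)
      _ ≤ w * ‖a + b‖ ^ 2 + w * ‖a - b‖ ^ 2 + w * ‖a + Complex.I • b‖ ^ 2
          + w * ‖a - Complex.I • b‖ ^ 2 := by
          simp only [norm_mul, Complex.norm_I, one_mul]
          gcongr <;> exact h' _
      _ = w * (‖a‖ ^ 2 + ‖b‖ ^ 2) * 4 := by linear_combination w * h1 + w * h2
  refine T.opNorm_le_bound (by positivity) fun y => ?_
  rcases eq_or_ne (T y) 0 with hT | hT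
  · rw [hT, norm_zero]; positivity
  have hy : y ≠ 0 := fun h0 => hT (by rw [h0, map_zero])
  have hT' : 0 < ‖T y‖ := norm_pos_iff.mpr hT
  have hy' : 0 < ‖y‖ := norm_pos_iff.mpr hy
  -- The test vector is `T y` rescaled to the norm of `y`, which turns the bound into `‖y‖ * ‖T y‖ ≤
  -- 2 * w * ‖y‖ ^ 2`.
  have := hsesq (((‖y‖ / ‖T y‖ : ℝ) : ℂ) • T y) y
  rw [inner_smul_right, norm_mul, norm_smul, inner_self_eq_norm_sq_to_K, norm_pow] at this
  simp only [Complex.norm_real, norm_div, norm_norm, Complex.coe_algebraMap] at this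
  rw [div_mul_cancel₀ _ hT'.ne'] at this
  have h3 : ‖y‖ / ‖T y‖ * ‖T y‖ ^ 2 = ‖y‖ * ‖T y‖ := by field_simp
  rw [h3] at this
  refine le_of_mul_le_mul_left ?_ hy'
  linarith

/-- A positive operator below a projection is supported in the range of the projection. -/
theorem mul_eq_self_of_nonneg_of_le [CompleteSpace H] {P B : H →L[ℂ] H} (hP : IsStarProjection P)
    (hB : 0 ≤ B) (hBP : B ≤ P) : B * P = B := by
  -- With `B = star S * S`, testing `B ≤ P` on a vector `v` of the kernel of `P` gives `‖S v‖ ^ 2 ≤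
  -- 0`.
  obtain ⟨S, rfl⟩ := CStarAlgebra.nonneg_iff_eq_star_mul_self.mp hB
  ext ψ
  have h0 : P (ψ - P ψ) = 0 := by
    have : P (P ψ) = P ψ := DFunLike.congr_fun hP.isIdempotentElem.eq ψ
    rw [map_sub, this, sub_self]
  have h1 := ((ContinuousLinearMap.le_def _ _).mp hBP).re_inner_nonneg_right (ψ - P ψ)
  have h2 : S (ψ - P ψ) = 0 := by
    rw [sub_apply, h0, zero_sub, inner_neg_right, ContinuousLinearMap.star_eq_adjoint,
      mul_apply_eq_comp, ContinuousLinearMap.adjoint_inner_right,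
      inner_self_eq_norm_sq_to_K] at h1
    have h3 : ‖S (ψ - P ψ)‖ ^ 2 ≤ 0 := by
      have h4 : (0 : ℝ) ≤ -(‖S (ψ - P ψ)‖ ^ 2) := by
        convert h1 using 1
        simp [← Complex.ofReal_pow]
      linarith
    simpa using le_antisymm h3 (sq_nonneg _)
  rw [map_sub, sub_eq_zero] at h2
  simp only [mul_apply_eq_comp, h2]

theorem commute_of_nonneg_of_le [CompleteSpace H] {P B : H →L[ℂ] H} (hP : IsStarProjection P)
    (hB : 0 ≤ B) (hBP : B ≤ P) : Commute P B := by
  have h := mul_eq_self_of_nonneg_of_le hP hB hBP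
  have h' := congrArg star h
  rw [star_mul, hP.isSelfAdjoint.star_eq, (IsSelfAdjoint.of_nonneg hB).star_eq] at h'
  exact h'.trans h.symm

end Operators

/-- A bounded measurable function is a uniform limit of simple functions. -/
theorem exists_simpleFunc_norm_sub_le {Ω : Type*} [MeasurableSpace Ω]
    {f : Ω → ℂ} (hf : Measurable f) {C : ℝ} (hC : ∀ y, ‖f y‖ ≤ C) {ε : ℝ} (hε : 0 < ε) :
    ∃ s : SimpleFunc Ω ℂ, ∀ y, ‖s y - f y‖ ≤ ε := by
  have key (g : Ω → ℝ) (hg : Measurable g) (hgC : ∀ y, |g y| ≤ C) :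
      ∃ s : SimpleFunc Ω ℝ, ∀ y, |s y - g y| ≤ ε / 2 := by
    -- Rounding down to multiples of `1 / n` costs at most `1 / n < ε / 2` in each of the real and
    -- imaginary parts.
    obtain ⟨n, hn⟩ := exists_nat_gt (2 / ε)
    have hn0 : (0 : ℝ) < n := (by positivity : (0 : ℝ) < 2 / ε).trans hn
    let k : SimpleFunc Ω ℤ :=
      { toFun := fun y => ⌊n * g y⌋
        measurableSet_fiber' := fun z =>
          (Int.measurable_floor.comp (hg.const_mul (n : ℝ))) (measurableSet_singleton z)
        finite_range' := (Set.finite_Icc ⌊-(n * C)⌋ ⌊n * C⌋).subset <| by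
          rintro _ ⟨y, rfl⟩
          have := abs_le.mp (hgC y)
          exact ⟨Int.floor_mono (by nlinarith), Int.floor_mono (by nlinarith)⟩ }
    refine ⟨k.map fun z : ℤ => (z : ℝ) / n, fun y => ?_⟩
    have h1 := Int.floor_le (n * g y)
    have h2 := Int.lt_floor_add_one (n * g y)
    have h3 : |(k y : ℝ) - n * g y| ≤ 1 := abs_le.mpr ⟨by change -1 ≤ (⌊n * g y⌋ : ℝ) - _; linarith,
      by change (⌊n * g y⌋ : ℝ) - _ ≤ 1; linarith⟩
    rw [SimpleFunc.map_apply]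
    have h4 : (k y : ℝ) / n - g y = ((k y : ℝ) - n * g y) / n := by field_simp
    rw [h4, abs_div, abs_of_pos hn0, div_le_iff₀ hn0]
    rw [div_lt_iff₀ hε] at hn
    linarith
  obtain ⟨a, ha⟩ := key (fun y => (f y).re) (Complex.measurable_re.comp hf)
    fun y => (Complex.abs_re_le_norm _).trans (hC y)
  obtain ⟨b, hb⟩ := key (fun y => (f y).im) (Complex.measurable_im.comp hf)
    fun y => (Complex.abs_im_le_norm _).trans (hC y)
  refine ⟨(a.pair b).map fun z => ⟨z.1, z.2⟩, fun y => ?_⟩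
  refine (Complex.norm_le_abs_re_add_abs_im _).trans ?_
  have h1 := ha y
  have h2 := hb y
  simp only [SimpleFunc.map_apply, SimpleFunc.pair_apply, Complex.sub_re, Complex.sub_im]
  linarith

/-! ### Observables: commuting projections and integration of bounded functions. -/

namespace Observable

variable {Ω : Type u} [MeasurableSpace Ω] {H : Type v} [NormedAddCommGroup H]
  [InnerProductSpace ℂ H] (E : Observable Ω H)

theorem empty : E ∅ = 0 := by
  refine eq_of_inner_self_eq fun ψ => ?_
  -- The constant series over copies of `∅` converges, which forces its term to vanish.
  have h := (E.sigmaAdditive (fun _ => ∅) (fun _ => .empty) (fun _ _ _ => disjoint_bot_left)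
    ψ ψ).summable
  rw [summable_const_iff] at h
  rw [h, zero_apply, inner_zero_right]

theorem union {X Y : Set Ω} (hX : MeasurableSet X) (hY : MeasurableSet Y) (h : Disjoint X Y) :
    E (X ∪ Y) = E X + E Y := by
  refine eq_of_inner_self_eq fun ψ => ?_
  let Z : ℕ → Set Ω := fun n => if n = 0 then X else if n = 1 then Y else ∅
  have hU : ⋃ i, Z i = X ∪ Y := by
    ext y
    simp only [Set.mem_iUnion, Set.mem_union]
    constructor
    · rintro ⟨i, hi⟩
      simp only [Z] at hi
      split_ifs at hi
      · exact .inl hi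
      · exact .inr hi
      · exact hi.elim
    · rintro (hy | hy)
      · exact ⟨0, by simpa [Z] using hy⟩
      · exact ⟨1, by simpa [Z] using hy⟩
  have h1 := E.sigmaAdditive Z (fun i => by dsimp only [Z]; split_ifs <;> simp [*])
    (fun i j hij => by
      dsimp only [Z]
      split_ifs <;> simp_all [h.symm]) ψ ψ
  have h2 : HasSum (fun i => ⟪ψ, E (Z i) ψ⟫_ℂ) (∑ i ∈ Finset.range 2, ⟪ψ, E (Z i) ψ⟫_ℂ) := by
    refine hasSum_sum_of_ne_finset_zero fun i hi => ?_
    rw [Finset.mem_range, not_lt] at hi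
    have : Z i = ∅ := by simp [Z, show i ≠ 0 by omega, show i ≠ 1 by omega]
    rw [this, E.empty, zero_apply, inner_zero_right]
  rw [hU] at h1
  rw [h1.unique h2, Finset.sum_range_succ, Finset.sum_range_one, add_apply, inner_add_right]
  simp [Z]

/-- A projection in the range of an observable commutes with the whole range. -/
theorem commute_of_isStarProjection [CompleteSpace H] {X Y : Set Ω} (hX : MeasurableSet X)
    (hY : MeasurableSet Y) (hP : IsStarProjection (E X)) : Commute (E X) (E Y) := by
  have hpos {Z : Set Ω} (hZ : MeasurableSet Z) : 0 ≤ E Z :=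
    (ContinuousLinearMap.nonneg_iff_isPositive _).mpr (E.isPositive Z hZ)
  have h1 : E X = E (Y ∩ X) + E (X \ Y) := by
    rw [← E.union (hY.inter hX) (hX.diff hY) (by
      rw [Set.disjoint_left]; exact fun a ha hb => hb.2 ha.1), Set.inter_comm,
      Set.inter_union_sdiff]
  have h2 : E Y = E (Y ∩ X) + E (Y \ X) := by
    rw [← E.union (hY.inter hX) (hY.diff hX) (by
      rw [Set.disjoint_left]; exact fun a ha hb => hb.2 ha.2), Set.inter_union_sdiff]
  have h3 : 1 - E X = E (Y \ X) + E (Yᶜ \ X) := by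
    rw [← E.normalized, ← Set.union_compl_self X, E.union hX hX.compl disjoint_compl_right,
      add_sub_cancel_left, ← E.union (hY.diff hX) (hY.compl.diff hX) (by
      rw [Set.disjoint_left]; exact fun a ha hb => hb.1 ha.1), ← Set.union_sdiff_distrib,
      Set.union_compl_self, Set.compl_eq_univ_sdiff]
  -- The part of `Y` inside `X` lies below `E X`, the part outside below the complementary
  -- projection.
  have c1 : Commute (E X) (E (Y ∩ X)) := commute_of_nonneg_of_le hP (hpos (hY.inter hX)) <| by
    rw [h1]; exact le_add_of_nonneg_right (hpos (hX.diff hY))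
  have c2 : Commute (1 - E X) (E (Y \ X)) :=
    commute_of_nonneg_of_le hP.one_sub (hpos (hY.diff hX)) <| by
      rw [h3]; exact le_add_of_nonneg_right (hpos (hY.compl.diff hX))
  have c3 : Commute (E X) (E (Y \ X)) := by
    have := (Commute.one_left (E (Y \ X))).sub_left c2
    rwa [sub_sub_cancel] at this
  rw [h2]
  exact c1.add_right c3

/-- The outcome distribution `X ↦ ⟪ψ, E(X)ψ⟫` of an observable in a vector state. -/
noncomputable def distribution (ψ : H) : Measure Ω :=
  Measure.ofMeasurable (fun X _ => ENNReal.ofReal (⟪ψ, E X ψ⟫_ℂ).re)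
    (by simp [E.empty]) (fun X hX hd => by
      have h := Complex.hasSum_re (E.sigmaAdditive X hX (fun _ _ hij => hd hij) ψ ψ)
      rw [← h.tsum_eq]
      exact ENNReal.ofReal_tsum_of_nonneg
        (fun n => (E.isPositive (X n) (hX n)).re_inner_nonneg_right ψ) h.summable)

theorem distribution_apply (ψ : H) {X : Set Ω} (hX : MeasurableSet X) :
    E.distribution ψ X = ENNReal.ofReal (⟪ψ, E X ψ⟫_ℂ).re :=
  Measure.ofMeasurable_apply X hX

instance (ψ : H) : IsFiniteMeasure (E.distribution ψ) :=
  ⟨by rw [E.distribution_apply ψ .univ]; exact ENNReal.ofReal_lt_top⟩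

theorem distribution_real_apply (ψ : H) {X : Set Ω} (hX : MeasurableSet X) :
    ((E.distribution ψ).real X : ℂ) = ⟪ψ, E X ψ⟫_ℂ := by
  have h := Complex.le_def.mp ((E.isPositive X hX).inner_nonneg_right ψ)
  rw [Measure.real, E.distribution_apply ψ hX, ENNReal.toReal_ofReal h.1]
  exact Complex.ext rfl h.2

theorem distribution_real_univ (ψ : H) : (E.distribution ψ).real Set.univ = ‖ψ‖ ^ 2 := by
  have h := E.distribution_real_apply ψ .univ
  rw [E.normalized, one_apply_eq_self, inner_self_eq_norm_sq_to_K] at h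
  exact Complex.ofReal_injective (h.trans (Complex.ofReal_pow _ 2).symm)

theorem exists_inner_eq_integral_simpleFunc (s : SimpleFunc Ω ℂ) :
    ∃ A : H →L[ℂ] H, ∀ ψ : H, ⟪ψ, A ψ⟫_ℂ = ∫ y, s y ∂(E.distribution ψ) := by
  refine ⟨∑ z ∈ s.range, z • E (s ⁻¹' {z}), fun ψ => ?_⟩
  rw [SimpleFunc.integral_eq_sum s (SimpleFunc.integrable_of_isFiniteMeasure s),
    sum_apply, inner_sum]
  refine Finset.sum_congr rfl fun z _ => ?_
  rw [smul_apply, inner_smul_right, ← E.distribution_real_apply ψ (s.measurableSet_fiber z),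
    Complex.real_smul, mul_comm]

/-- Bounded measurable functions can be integrated against an observable. -/
theorem exists_inner_eq_integral [CompleteSpace H] {f : Ω → ℂ} (hf : Measurable f) {C : ℝ}
    (hC : ∀ y, ‖f y‖ ≤ C) :
    ∃ A : H →L[ℂ] H, ∀ ψ : H, ⟪ψ, A ψ⟫_ℂ = ∫ y, f y ∂(E.distribution ψ) := by
  have hint (ψ : H) : Integrable f (E.distribution ψ) :=
    Integrable.of_bound hf.aestronglyMeasurable C (.of_forall hC)
  have happrox (n : ℕ) : ∃ A : H →L[ℂ] H,
      ∀ ψ : H, ‖⟪ψ, A ψ⟫_ℂ - ∫ y, f y ∂(E.distribution ψ)‖ ≤ 1 / ((n : ℝ) + 1) * ‖ψ‖ ^ 2 := by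
    obtain ⟨s, hs⟩ := exists_simpleFunc_norm_sub_le hf hC (Nat.one_div_pos_of_nat (n := n))
    obtain ⟨A, hA⟩ := E.exists_inner_eq_integral_simpleFunc s
    refine ⟨A, fun ψ => ?_⟩
    rw [hA, ← integral_sub (SimpleFunc.integrable_of_isFiniteMeasure s) (hint ψ),
      ← E.distribution_real_univ]
    exact norm_integral_le_of_norm_le_const (.of_forall hs)
  choose A hA using happrox
  have hlim : Filter.Tendsto (fun n : ℕ => 1 / ((n : ℝ) + 1)) .atTop (nhds 0) :=
    tendsto_one_div_add_atTop_nhds_zero_nat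
  have hcauchy : CauchySeq A := by
    refine cauchySeq_of_le_tendsto_0 (fun N : ℕ => 4 * (1 / ((N : ℝ) + 1)))
      (fun n m N hn hm => ?_) (by simpa using hlim.const_mul 4)
    -- Two approximations, each within `1 / (N + 1)` of the integral, contribute one factor 2;
    -- passing from numerical radius to norm contributes the other.
    rw [dist_eq_norm, show (4 : ℝ) * (1 / ((N : ℝ) + 1)) = 2 * (2 * (1 / ((N : ℝ) + 1))) by ring]
    refine norm_le_two_mul_of_norm_inner_self_le (by positivity) fun ψ => ?_
    have hle {k : ℕ} (hk : N ≤ k) : ‖⟪ψ, A k ψ⟫_ℂ - ∫ y, f y ∂(E.distribution ψ)‖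
        ≤ 1 / ((N : ℝ) + 1) * ‖ψ‖ ^ 2 :=
      (hA k ψ).trans (by gcongr)
    rw [sub_apply, inner_sub_right]
    refine (norm_sub_le_norm_sub_add_norm_sub _ (∫ y, f y ∂(E.distribution ψ)) _).trans ?_
    rw [norm_sub_rev (∫ y, f y ∂(E.distribution ψ))]
    linarith [hle hn, hle hm]
  obtain ⟨B, hB⟩ := cauchySeq_tendsto_of_complete hcauchy
  refine ⟨B, fun ψ => ?_⟩
  have h1 : Filter.Tendsto (fun n => ⟪ψ, A n ψ⟫_ℂ) .atTop (nhds ⟪ψ, B ψ⟫_ℂ) :=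
    Filter.Tendsto.inner tendsto_const_nhds
      (((ContinuousLinearMap.apply ℂ H ψ).continuous.tendsto B).comp hB)
  have h2 : Filter.Tendsto (fun n => ⟪ψ, A n ψ⟫_ℂ) .atTop
      (nhds (∫ y, f y ∂(E.distribution ψ))) := by
    rw [tendsto_iff_norm_sub_tendsto_zero]
    exact squeeze_zero (fun _ => norm_nonneg _) (fun n => hA n ψ)
      (by simpa using hlim.mul_const (‖ψ‖ ^ 2))
  exact tendsto_nhds_unique h1 h2

end Observable

/-! ### The Weyl system on `L²(ℝ)`. -/

theorem star_eq_of_mul_eq_one {H : Type*} [NormedAddCommGroup H] [InnerProductSpace ℂ H]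
    [CompleteSpace H] {A B : H →L[ℂ] H} (hA : ∀ ψ, ‖A ψ‖ ≤ ‖ψ‖) (hB : ∀ ψ, ‖B ψ‖ ≤ ‖ψ‖)
    (hAB : A * B = 1) (hBA : B * A = 1) : star A = B := by
  -- A contraction with contractive inverse is isometric.
  have hnorm (ψ : H) : ‖A ψ‖ = ‖ψ‖ := by
    refine le_antisymm (hA ψ) ?_
    calc ‖ψ‖ = ‖B (A ψ)‖ := by rw [← mul_apply_eq_comp, hBA, one_apply_eq_self]
      _ ≤ ‖A ψ‖ := hB _
  have h : star A * A = 1 := (ContinuousLinearMap.norm_map_iff_adjoint_comp_self A).mp hnorm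
  calc star A = star A * (A * B) := by rw [hAB, mul_one]
    _ = B := by rw [← mul_assoc, h, one_mul]

theorem spaceTranslation_mul (q r : ℝ) :
    spaceTranslation q * spaceTranslation r = spaceTranslation (q + r) := by
  ext1 ψ
  refine Lp.ext ?_
  filter_upwards [spaceTranslation_ae q (spaceTranslation r ψ), spaceTranslation_ae (q + r) ψ,
    (measurePreserving_sub_right volume q).quasiMeasurePreserving.ae (spaceTranslation_ae r ψ)]
    with x h1 h2 h3
  rw [mul_apply_eq_comp, h1, h2, h3, sub_sub]

theorem spaceTranslation_zero : spaceTranslation 0 = 1 := by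
  ext1 ψ
  refine Lp.ext ?_
  filter_upwards [spaceTranslation_ae 0 ψ] with x h
  rw [h, sub_zero, one_apply_eq_self]

theorem velocityBoost_mul (p r : ℝ) :
    velocityBoost p * velocityBoost r = velocityBoost (p + r) := by
  ext1 ψ
  refine Lp.ext ?_
  filter_upwards [velocityBoost_ae p (velocityBoost r ψ), velocityBoost_ae (p + r) ψ,
    velocityBoost_ae r ψ] with x h1 h2 h3
  rw [mul_apply_eq_comp, h1, h2, h3, ← mul_assoc, ← Complex.exp_add]
  push_cast
  ring_nf

theorem velocityBoost_zero : velocityBoost 0 = 1 := by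
  ext1 ψ
  refine Lp.ext ?_
  filter_upwards [velocityBoost_ae 0 ψ] with x h
  simp [h]

/-- The Weyl commutation relation. -/
theorem velocityBoost_mul_spaceTranslation (p q : ℝ) :
    velocityBoost p * spaceTranslation q =
      Complex.exp ((p * q : ℝ) * Complex.I) • (spaceTranslation q * velocityBoost p) := by
  ext1 ψ
  refine Lp.ext ?_
  filter_upwards [velocityBoost_ae p (spaceTranslation q ψ), spaceTranslation_ae q ψ,
    spaceTranslation_ae q (velocityBoost p ψ),
    (measurePreserving_sub_right volume q).quasiMeasurePreserving.ae (velocityBoost_ae p ψ),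
    Lp.coeFn_smul (Complex.exp ((p * q : ℝ) * Complex.I))
      (spaceTranslation q (velocityBoost p ψ))] with x h1 h2 h3 h4 h5
  rw [mul_apply_eq_comp, smul_apply, mul_apply_eq_comp, h1, h2, h5,
    Pi.smul_apply, h3, h4, smul_eq_mul, ← mul_assoc, ← Complex.exp_add]
  push_cast
  ring_nf

theorem star_spaceTranslation (q : ℝ) : star (spaceTranslation q) = spaceTranslation (-q) := by
  have h (r : ℝ) (ψ : L2R) : ‖spaceTranslation r ψ‖ ≤ ‖ψ‖ :=
    (LinearIsometry.norm_map (Lp.compMeasurePreservingₗᵢ ℂ (fun x : ℝ => x - r)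
      (measurePreserving_sub_right volume r)) ψ).le
  exact star_eq_of_mul_eq_one (h q) (h (-q))
    (by rw [spaceTranslation_mul, add_neg_cancel, spaceTranslation_zero])
    (by rw [spaceTranslation_mul, neg_add_cancel, spaceTranslation_zero])

theorem star_velocityBoost (p : ℝ) : star (velocityBoost p) = velocityBoost (-p) := by
  have h (r : ℝ) (ψ : L2R) : ‖velocityBoost r ψ‖ ≤ ‖ψ‖ := by
    refine Lp.norm_le_norm_of_ae_le ?_
    filter_upwards [velocityBoost_ae r ψ] with x h
    rw [h, norm_boost_mul]
  exact star_eq_of_mul_eq_one (h p) (h (-p))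
    (by rw [velocityBoost_mul, add_neg_cancel, velocityBoost_zero])
    (by rw [velocityBoost_mul, neg_add_cancel, velocityBoost_zero])

theorem spaceTranslation_mem_unitary (q : ℝ) : spaceTranslation q ∈ unitary (L2R →L[ℂ] L2R) := by
  rw [Unitary.mem_iff, star_spaceTranslation, spaceTranslation_mul, spaceTranslation_mul,
    neg_add_cancel, add_neg_cancel, spaceTranslation_zero]
  exact ⟨rfl, rfl⟩

theorem velocityBoost_mem_unitary (p : ℝ) : velocityBoost p ∈ unitary (L2R →L[ℂ] L2R) := by
  rw [Unitary.mem_iff, star_velocityBoost, velocityBoost_mul, velocityBoost_mul,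
    neg_add_cancel, add_neg_cancel, velocityBoost_zero]
  exact ⟨rfl, rfl⟩

/-! ### Irreducibility of the Weyl system. -/

open FourierTransform in
/-- An integrable function is determined by its Fourier transform. -/
theorem ae_eq_zero_of_forall_integral_exp_mul_eq_zero {f : ℝ → ℂ} (hf : Integrable f)
    (h : ∀ p : ℝ, ∫ x : ℝ, Complex.exp (Complex.I * p * x) * f x = 0) : ∀ᵐ x, f x = 0 := by
  have hF (ξ : ℝ) : 𝓕 f ξ = 0 := by
    rw [Real.fourier_real_eq_integral_exp_smul, ← h (-2 * Real.pi * ξ)]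
    congr 1
    ext x
    rw [smul_eq_mul]
    push_cast
    ring_nf
  refine ae_eq_zero_of_integral_contDiff_smul_eq_zero hf.locallyIntegrable
    fun g g_smooth g_cpt => ?_
  have hg₁ : HasCompactSupport (Complex.ofRealCLM ∘ g) := g_cpt.comp_left rfl
  have hg₂ : ContDiff ℝ (⊤ : ℕ∞) (Complex.ofRealCLM ∘ g) := by fun_prop
  set G : SchwartzMap ℝ ℂ := hg₁.toSchwartzMap hg₂
  set K : SchwartzMap ℝ ℂ := 𝓕⁻ G
  have hK : 𝓕 K = G := FourierTransform.fourier_fourierInv_eq G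
  -- A test function is the Fourier transform of a Schwartz function `K`; moving the transform from
  -- `K` to `f` makes the pairing zero.
  have hflip : ∫ ξ, 𝓕 (K : ℝ → ℂ) ξ • f ξ = ∫ x, K x • 𝓕 f x := by
    simpa using! VectorFourier.integral_fourierIntegral_smul_eq_flip (L := innerₗ ℝ)
      Real.continuous_fourierChar continuous_inner K.integrable hf
  simp only [hF, smul_zero, integral_zero] at hflip
  rw [← SchwartzMap.fourier_coe, hK] at hflip
  simpa [G] using hflip

/-- The null set depends on `q`; Fubini exchanges the quantifiers, so one fixed `x` works for almost
every `q`, and `y = x - q` then covers almost every point. -/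
theorem exists_ae_eq_const_of_forall_translate_ae_eq {m : ℝ → ℂ} (hm : Measurable m)
    (h : ∀ q : ℝ, ∀ᵐ x, m (x - q) = m x) : ∃ c, ∀ᵐ x, m x = c := by
  have hmeas : MeasurableSet {z : ℝ × ℝ | m (z.2 - z.1) = m z.2} :=
    measurableSet_eq_fun (by fun_prop) (by fun_prop)
  have h2 : ∀ᵐ x : ℝ, ∀ᵐ q : ℝ, m (x - q) = m x :=
    (Measure.ae_ae_comm hmeas).mp (.of_forall h)
  obtain ⟨x, hx⟩ := h2.exists
  refine ⟨m x, ?_⟩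
  filter_upwards [(Measure.measurePreserving_sub_left volume x).quasiMeasurePreserving.ae hx] with y hy
  rwa [sub_sub_cancel] at hy

/-- The canonical representation of the Weyl relations on `L²(ℝ)` is irreducible. -/
theorem exists_eq_smul_one_of_commute {T : L2R →L[ℂ] L2R}
    (hU : ∀ q, Commute T (spaceTranslation q)) (hV : ∀ p, Commute T (velocityBoost p)) :
    ∃ c : ℂ, T = c • 1 := by
  have hgauss : MemLp (fun x : ℝ => (Real.exp (-x ^ 2) : ℂ)) 2 volume := by
    refine (memLp_two_iff_integrable_sq_norm
      (Continuous.aestronglyMeasurable (by fun_prop))).mpr ?_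
    convert integrable_exp_neg_mul_sq (b := 2) (by norm_num) using 2 with x
    rw [Complex.norm_real, Real.norm_eq_abs, sq_abs, ← Real.exp_nat_mul]
    push_cast
    ring_nf
  set g : L2R := hgauss.toLp
  have hg : g =ᵐ[volume] fun x : ℝ => (Real.exp (-x ^ 2) : ℂ) := hgauss.coeFn_toLp
  -- If `T` is multiplication by `m`, then `star T` multiplies the nowhere vanishing Gaussian `g` by
  -- the conjugate of `m`; solving for `m` gives this candidate.
  set m : ℝ → ℂ := fun x => (starRingEnd ℂ) ((star T) g x / (Real.exp (-x ^ 2) : ℂ)) with hm_def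
  have hm : Measurable m := by
    have : Measurable ((star T) g : ℝ → ℂ) := (Lp.stronglyMeasurable _).measurable
    have h2 : Measurable fun x => (star T) g x / (Real.exp (-x ^ 2) : ℂ) := by fun_prop
    exact Complex.continuous_conj.measurable.comp h2
  have hexp (x : ℝ) : (Real.exp (-x ^ 2) : ℂ) ≠ 0 := by
    exact_mod_cast (Real.exp_pos _).ne'
  have hmul (φ : L2R) : ∀ᵐ x, T φ x = m x * φ x := by
    have hint1 : Integrable fun x => ⟪T φ x, g x⟫_ℂ := L2.integrable_inner (T φ) g
    have hint2 : Integrable fun x => ⟪φ x, (star T) g x⟫_ℂ := L2.integrable_inner φ ((star T) g)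
    -- Moving `T` across the inner product with the boosted `g` shows that the two pointwise inner
    -- products have the same Fourier transform.
    have hzero := ae_eq_zero_of_forall_integral_exp_mul_eq_zero (hint1.sub hint2) fun p => by
      have hstar : Commute (star T) (velocityBoost p) := by
        have := (hV (-p)).star_star
        rwa [star_velocityBoost, neg_neg] at this
      have e1 : ⟪T φ, velocityBoost p g⟫_ℂ
          = ∫ x : ℝ, Complex.exp (Complex.I * p * x) * ⟪T φ x, g x⟫_ℂ := by
        rw [L2.inner_def]
        refine integral_congr_ae ?_
        filter_upwards [velocityBoost_ae p g] with x hx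
        rw [hx, ← smul_eq_mul, inner_smul_right]
      have e2 : ⟪φ, velocityBoost p ((star T) g)⟫_ℂ
          = ∫ x : ℝ, Complex.exp (Complex.I * p * x) * ⟪φ x, (star T) g x⟫_ℂ := by
        rw [L2.inner_def]
        refine integral_congr_ae ?_
        filter_upwards [velocityBoost_ae p ((star T) g)] with x hx
        rw [hx, ← smul_eq_mul, inner_smul_right]
      have e3 : ⟪T φ, velocityBoost p g⟫_ℂ = ⟪φ, velocityBoost p ((star T) g)⟫_ℂ := by
        rw [← mul_apply_eq_comp, ← hstar.eq, mul_apply_eq_comp,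
          ContinuousLinearMap.star_eq_adjoint, ContinuousLinearMap.adjoint_inner_right]
      have hb (k : ℝ → ℂ) (hk : Integrable k) :
          Integrable fun x : ℝ => Complex.exp (Complex.I * p * x) * k x :=
        hk.congr' (AEStronglyMeasurable.mul (Continuous.aestronglyMeasurable (by fun_prop))
          hk.aestronglyMeasurable) (.of_forall fun x => (norm_boost_mul p k x).symm)
      simp only [Pi.sub_apply, mul_sub]
      rw [integral_sub (hb _ hint1) (hb _ hint2), ← e1, ← e2, e3, sub_self]
    filter_upwards [hzero, hg] with x h1 h2
    rw [Pi.sub_apply, sub_eq_zero, RCLike.inner_apply, RCLike.inner_apply, h2] at h1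
    have h3 := congrArg (starRingEnd ℂ) h1
    simp only [map_mul, Complex.conj_conj, Complex.conj_ofReal] at h3
    rw [hm_def]
    simp only [map_div₀, Complex.conj_ofReal]
    rw [div_mul_eq_mul_div, ← h3, mul_div_cancel_left₀ _ (hexp x)]
  obtain ⟨c, hc⟩ := exists_ae_eq_const_of_forall_translate_ae_eq hm fun q => by
    have hq := (measurePreserving_sub_right (volume : Measure ℝ) q).quasiMeasurePreserving
    have hcomm : T (spaceTranslation q g) = spaceTranslation q (T g) :=
      DFunLike.congr_fun (hU q).eq g
    have h0 := hmul (spaceTranslation q g)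
    rw [hcomm] at h0
    filter_upwards [h0, spaceTranslation_ae q g, spaceTranslation_ae q (T g), hq.ae (hmul g),
      hq.ae hg] with x h1 h2 h3 h4 h5
    rw [h2, h3, h4, h5] at h1
    exact mul_right_cancel₀ (hexp _) h1
  refine ⟨c, ?_⟩
  ext1 φ
  refine Lp.ext ?_
  filter_upwards [hmul φ, hc, Lp.coeFn_smul c φ] with x h1 h2 h3
  rw [h1, h2, smul_apply, one_apply_eq_self, h3, Pi.smul_apply, smul_eq_mul]

/-! ### Covariance, invariance and the triviality of commuting projections. -/

section Conjugation

variable {H : Type*} [NormedAddCommGroup H] [InnerProductSpace ℂ H] [CompleteSpace H]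

theorem commute_of_conj_eq {W A : H →L[ℂ] H} (hW : W ∈ unitary (H →L[ℂ] H))
    (h : W * A * star W = A) : Commute W A := by
  have h2 := congrArg (· * W) h
  simp only [mul_assoc, Unitary.star_mul_self_of_mem hW, mul_one] at h2
  exact h2

namespace Observable

theorem distribution_apply_eq_of_commute {Ω : Type*} [MeasurableSpace Ω] (F : Observable Ω H)
    {W : H →L[ℂ] H} (hW : W ∈ unitary (H →L[ℂ] H))
    (h : ∀ Y, MeasurableSet Y → Commute W (F Y)) (ψ : H) :
    F.distribution (W ψ) = F.distribution ψ := by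
  ext Y hY
  have h1 : F Y (W ψ) = W (F Y ψ) := DFunLike.congr_fun (h Y hY).eq.symm ψ
  rw [F.distribution_apply _ hY, F.distribution_apply _ hY, h1,
    ← ContinuousLinearMap.adjoint_inner_right, ← ContinuousLinearMap.star_eq_adjoint,
    ← mul_apply_eq_comp, Unitary.star_mul_self_of_mem hW, one_apply_eq_self]

theorem distribution_star_apply (F : Observable ℝ H) {W : H →L[ℂ] H} {p : ℝ}
    (h : ∀ Y, MeasurableSet Y → W * F Y * star W = F ((fun y => y + p) '' Y)) (ψ : H) :
    F.distribution (star W ψ) = (F.distribution ψ).map fun y => y - p := by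
  have hmeas : Measurable fun y : ℝ => y - p := measurable_id.sub_const p
  ext Y hY
  have himg : (fun y : ℝ => y - p) ⁻¹' Y = (fun y => y + p) '' Y :=
    (congrFun (Set.image_eq_preimage_of_inverse (f := fun y => y + p)
      (fun y => add_sub_cancel_right y p) fun y => sub_add_cancel y p) Y).symm
  rw [Measure.map_apply hmeas hY, F.distribution_apply _ hY, F.distribution_apply _ (hmeas hY),
    himg, ← h Y hY, ContinuousLinearMap.star_eq_adjoint, ContinuousLinearMap.adjoint_inner_left]
  rfl

theorem commute_of_inner_eq_integral {Ω : Type*} [MeasurableSpace Ω] (F : Observable Ω H)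
    {f : Ω → ℂ} {A : H →L[ℂ] H} (hA : ∀ ψ : H, ⟪ψ, A ψ⟫_ℂ = ∫ y, f y ∂(F.distribution ψ))
    {W : H →L[ℂ] H} (hW : W ∈ unitary (H →L[ℂ] H))
    (h : ∀ Y, MeasurableSet Y → Commute W (F Y)) : Commute W A := by
  have h1 : star W * A * W = A := eq_of_inner_self_eq fun ψ => by
    rw [mul_apply_eq_comp, mul_apply_eq_comp, ContinuousLinearMap.star_eq_adjoint,
      ContinuousLinearMap.adjoint_inner_right, hA, hA, F.distribution_apply_eq_of_commute hW h]
  have h2 := congrArg (W * ·) h1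
  simp only [← mul_assoc, Unitary.mul_star_self_of_mem hW, one_mul] at h2
  exact h2.symm

/-- Conjugation by `W` shifts the outcome by `p`, and a shift multiplies the exponential by a
constant phase. -/
theorem conj_eq_exp_smul (F : Observable ℝ H) {t : ℝ} {A : H →L[ℂ] H}
    (hA : ∀ ψ : H, ⟪ψ, A ψ⟫_ℂ = ∫ y : ℝ, Complex.exp (t * y * Complex.I) ∂(F.distribution ψ))
    {W : H →L[ℂ] H} (hW : W ∈ unitary (H →L[ℂ] H)) {p : ℝ}
    (h : ∀ Y, MeasurableSet Y → W * F Y * star W = F ((fun y => y + p) '' Y)) :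
    W * A = Complex.exp (-(t * p * Complex.I)) • (A * W) := by
  have h1 : W * A * star W = Complex.exp (-(t * p * Complex.I)) • A :=
    eq_of_inner_self_eq fun ψ => by
      have hmeas : AEMeasurable (fun y : ℝ => y - p) (F.distribution ψ) := by fun_prop
      rw [mul_apply_eq_comp, mul_apply_eq_comp, ← ContinuousLinearMap.adjoint_inner_left,
        ← ContinuousLinearMap.star_eq_adjoint, hA, F.distribution_star_apply h,
        integral_map hmeas (Continuous.aestronglyMeasurable (by fun_prop)), smul_apply,
        inner_smul_right, hA, ← integral_const_mul]
      congr 1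
      ext y
      rw [← Complex.exp_add]
      push_cast
      ring_nf
  have h2 := congrArg (· * W) h1
  simpa only [mul_assoc, Unitary.star_mul_self_of_mem hW, mul_one, smul_mul_assoc] using h2

/-- In an irreducible representation of the Weyl relations, a projection commuting with one of the
two groups and with an observable covariant under that group, invariant under the other, is
trivial. -/
theorem eq_zero_or_eq_one_of_commute_covariant {U V : ℝ → H →L[ℂ] H} {σ : ℝ}
    (hU : ∀ q, U q ∈ unitary (H →L[ℂ] H)) (hV : ∀ p, V p ∈ unitary (H →L[ℂ] H))
    (hU0 : U 0 = 1) (hUmul : ∀ q r, U q * U r = U (q + r))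
    (weyl : ∀ p q, V p * U q = Complex.exp ((σ * (p * q) : ℝ) * Complex.I) • (U q * V p))
    (irred : ∀ T : H →L[ℂ] H, (∀ q, Commute T (U q)) → (∀ p, Commute T (V p)) →
      ∃ c : ℂ, T = c • 1)
    (F : Observable ℝ H)
    (hcov : ∀ p Y, MeasurableSet Y → V p * F Y * star (V p) = F ((fun y => y + p) '' Y))
    (hinv : ∀ q Y, MeasurableSet Y → U q * F Y * star (U q) = F Y)
    {P : H →L[ℂ] H} (hP : IsStarProjection P) (hPF : ∀ Y, MeasurableSet Y → Commute P (F Y))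
    (hPV : ∀ p, Commute P (V p)) : P = 0 ∨ P = 1 := by
  rcases subsingleton_or_nontrivial H with hH | hH
  · exact .inl (Subsingleton.elim _ _)
  obtain ⟨ψ, hψ⟩ := exists_ne (0 : H)
  -- The commutation lemma for integrals needs a unitary, so `P` is replaced by the reflection `2 *
  -- P - 1`.
  have hS := hP.two_mul_sub_one_mem_unitary
  have hSF (Y : Set ℝ) (hY : MeasurableSet Y) : Commute (2 * P - 1) (F Y) :=
    (((Nat.cast_commute 2 (F Y)).mul_left (hPF Y hY)).sub_left (Commute.one_left _))
  have hsmall (q : ℝ) (hq : charFun (F.distribution ψ) (σ * q) ≠ 0) : Commute P (U q) := by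
    obtain ⟨A, hA⟩ := F.exists_inner_eq_integral
      (f := fun y : ℝ => Complex.exp (((σ * q : ℝ) : ℂ) * y * Complex.I)) (by fun_prop) (C := 1)
      fun y => by rw [← Complex.ofReal_mul, Complex.norm_exp_ofReal_mul_I]
    have hAU (r : ℝ) : Commute A (U r) := (F.commute_of_inner_eq_integral hA (hU r)
      fun Y hY => commute_of_conj_eq (hU r) (hinv r Y hY)).symm
    -- Frequency `σ * q` is chosen so that the phase from moving `V p` past `A` cancels the Weyl
    -- phase from moving it past `U q`.
    obtain ⟨c, hc⟩ := irred (A * U q)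
      (fun r => (hAU r).mul_left (by rw [Commute, SemiconjBy, hUmul, hUmul, add_comm]))
      (fun p => by
        have h1 := F.conj_eq_exp_smul hA (hV p) (hcov p)
        symm
        rw [Commute, SemiconjBy, ← mul_assoc, h1, smul_mul_assoc, mul_assoc A, weyl,
          mul_smul_comm, smul_smul, ← Complex.exp_add, ← mul_assoc A (U q)]
        have h0 : -(((σ * q : ℝ) : ℂ) * p * Complex.I) + (σ * (p * q) : ℝ) * Complex.I = 0 := by
          push_cast
          ring
        rw [h0, Complex.exp_zero, one_smul])
    have hA' : A = c • star (U q) := by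
      have := congrArg (· * star (U q)) hc
      simpa only [mul_assoc, Unitary.mul_star_self_of_mem (hU q), mul_one, smul_mul_assoc,
        one_mul] using this
    have hc0 : c ≠ 0 := by
      rintro rfl
      apply hq
      rw [charFun_apply_real, ← hA, hA', zero_smul, zero_apply, inner_zero_right]
    have hPA : Commute P A := by
      have h2 : Commute ((2 : ℂ) • P) A := by
        have := (F.commute_of_inner_eq_integral hA hS hSF).add_left (Commute.one_left A)
        rwa [sub_add_cancel, two_mul, ← two_smul ℂ] at this
      simpa using h2.smul_left (2⁻¹ : ℂ)
    have hPU : Commute P (star (U q)) := by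
      have := hPA.smul_right c⁻¹
      rwa [hA', smul_smul, inv_mul_cancel₀ hc0, one_smul] at this
    simpa only [hP.isSelfAdjoint.star_eq, star_star] using hPU.star_star
  have hUpow (r : ℝ) (n : ℕ) : U (n * r) = U r ^ n := by
    induction n with
    | zero => simpa using hU0
    | succ k ih => rw [pow_succ, ← ih, hUmul]; push_cast; ring_nf
  have hcomm (q : ℝ) : Commute P (U q) := by
    have hne : charFun (F.distribution ψ) 0 ≠ 0 := by
      rw [charFun_zero, F.distribution_real_univ]
      exact_mod_cast (pow_pos (norm_pos_iff.mpr hψ) 2).ne'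
    have hlim : Filter.Tendsto (fun n : ℕ => σ * (q * (1 / ((n : ℝ) + 1)))) .atTop (nhds 0) := by
      simpa using (tendsto_one_div_add_atTop_nhds_zero_nat.const_mul q).const_mul σ
    obtain ⟨n, hn⟩ := (hlim.eventually (continuous_charFun.continuousAt.eventually_ne hne)).exists
    -- A small fraction of `q` is already covered by `hsmall`, and `U q` is a power of the
    -- corresponding operator.
    have hq : q = ((n + 1 : ℕ) : ℝ) * (q * (1 / ((n : ℝ) + 1))) := by
      push_cast
      field_simp
    rw [hq, hUpow]
    exact (hsmall _ hn).pow_right _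
  obtain ⟨c, rfl⟩ := irred P hcomm hPV
  have h := DFunLike.congr_fun hP.isIdempotentElem.eq ψ
  simp only [smul_mul_smul_comm, mul_one, smul_apply, one_apply_eq_self] at h
  have hcc : c * c = c := smul_left_injective ℂ hψ h
  rcases eq_or_ne c 0 with rfl | hc
  · exact .inl (zero_smul _ _)
  · exact .inr (by rw [mul_right_cancel₀ hc (hcc.trans (one_mul c).symm), one_smul])

end Observable

end Conjugation

/-! ### The proposition. -/

theorem mainTheorem4 (E F : Observable ℝ L2R)
    (hE : IsPositionObservable E) (hF : IsMomentumObservable F)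
    (hproj : ∃ P ∈ E.ran ∪ F.ran, IsStarProjection P ∧ P ≠ 0 ∧ P ≠ 1) :
    ¬ Coexistent.{0, 0, 0, u} E F := by
  rintro ⟨Ω, _, G, hG⟩
  obtain ⟨P, hPmem, hP, hP0, hP1⟩ := hproj
  obtain ⟨Z, hZ, rfl⟩ := hG hPmem
  have hPG {B : L2R →L[ℂ] L2R} (hB : B ∈ E.ran ∪ F.ran) : Commute (G Z) B := by
    obtain ⟨Z', hZ', rfl⟩ := hG hB
    exact G.commute_of_isStarProjection hZ hZ' hP
  suffices h : G Z = 0 ∨ G Z = 1 from h.elim hP0 hP1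
  rcases hPmem with ⟨X, hX, hXP⟩ | ⟨Y, hY, hYP⟩
  · refine Observable.eq_zero_or_eq_one_of_commute_covariant (σ := 1)
      spaceTranslation_mem_unitary velocityBoost_mem_unitary spaceTranslation_zero
      spaceTranslation_mul (fun p q => by rw [velocityBoost_mul_spaceTranslation, one_mul])
      (fun T hU hV => exists_eq_smul_one_of_commute hU hV) F hF.1 hF.2 hP
      (fun Y hY => hPG (.inr ⟨Y, hY, rfl⟩)) fun p => ?_
    rw [← hXP]
    exact (commute_of_conj_eq (velocityBoost_mem_unitary p) (hE.2 p X hX)).symm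
  -- Exchanging translations and boosts inverts the Weyl phase, hence the sign `-1`.
  · refine Observable.eq_zero_or_eq_one_of_commute_covariant (σ := -1)
      velocityBoost_mem_unitary spaceTranslation_mem_unitary velocityBoost_zero
      velocityBoost_mul (fun p q => ?_)
      (fun T hV hU => exists_eq_smul_one_of_commute hU hV) E hE.1 hE.2 hP
      (fun X hX => hPG (.inl ⟨X, hX, rfl⟩)) fun q => ?_
    · rw [velocityBoost_mul_spaceTranslation, smul_smul, ← Complex.exp_add]
      have h0 : ((-1 * (p * q) : ℝ) : ℂ) * Complex.I + (q * p : ℝ) * Complex.I = 0 := by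
        push_cast
        ring
      rw [h0, Complex.exp_zero, one_smul]
    · rw [← hYP]
      exact (commute_of_conj_eq (spaceTranslation_mem_unitary q) (hF.2 q Y hY)).symm
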